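/- There is an absolute constant $C>0$ with the following property. Let $G=(V,E)$ be a finite directed graph without loops (parallel and antiparallel edges are allowed) with $n=|V|$ nodes and $m=|E|\ge 1$ edges, with integer capacities $u_e\in\mathbb{N}_0$ ($e\in E$) and integer budgets $b_v\in\mathbb{Z}$ ($v\in V$). Let $E_v$ be the set of edges incident to $v$, and let $\Delta(v,e)=1$ if $e$ leaves $v$ and $\Delta(v,e)=-1$ if $e$ enters $v$. A flow is a vector $f\in\mathbb{R}^E$ with $0\le f_e\le u_e$ for all $e\in E$ and $\sum_{e\in E_v}\Delta(v,e)f_e=b_v$ for all $v\in V$; assume that a flow exists. Let $\phi\in\mathbb{R}$, and let the edge costs $c_e$, $e\in E$, be independent random variables, where $c_e$ has a probability density $f_e:[0,1]\to[0,\phi]$. A min-cost flow is a flow that minimizes $\sum_{e} c_e f_e$. Consider the max-product (min-sum) belief propagation algorithm for min-cost flow. Put $\varphi_e(z)=c_e z$ if $0\le z\le u_e$ and $\varphi_e(z)=\infty$ otherwise, and, for $\bar z\in\mathbb{R}^{E_v}$, $\psi_v(\bar z)=0$ if $\sum_{e\in E_v}\Delta(v,e)\bar z_e=b_v$ and $\psi_v(\bar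 z)=\infty$ otherwise. For every edge $e$ with endpoints $v$ and $w$ (in either order) the messages are updated by \[ m^{t+1}_{e\to v}(z)=\varphi_e(z)+\inf_{\bar z\in\mathbb{R}^{E_w},\ \bar z_e=z}\Bigl\{\psi_w(\bar z)+\sum_{e'\in E_w\setminus\{e\}}m^{t}_{e'\to w}(\bar z_{e'})\Bigr\},\qquad z\in\mathbb{R}, \] starting either from $m^0_{e\to v}=0$ for all $e$ and $v$ or from $m^0_{e\to v}=\varphi_e$ for all $e$ and $v$ (the result holds for both initializations). The belief of $e=(v,w)$ after $t$ iterations is $b^t_e(z)=m^t_{e\to v}(z)+m^t_{e\to w}(z)-\varphi_e(z)$ for $0\le z\le u_e$ and $b^t_e(z)=\infty$ otherwise, and the estimate of the flow on $e$ is the minimizer of $b^t_e$. Let $\tau\in\{1,2,\dots\}\cup\{\infty\}$ be the number of iterations until convergence, i.e., the least $N\ge 1$ such that, for some min-cost flow $x$ and all $t\ge N$ and all $e\in E$, the function $b^t_e$ has $x_e$ as its unique minimizer ($\tau=\infty$ if there is no such $N$). Then, for all real $t>0$, \[ \mathbb{P}(\tau\ge t)\le C\cdot\frac{n^2 m\phi}{t}.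 \] In particular, the bound does not depend on the capacities or the budgets. -/

import Mathlib

open MeasureTheory ProbabilityTheory Set

/-- The combinatorial data of a min-cost flow instance on a finite directed graph without loops
(parallel and antiparallel edges are allowed): integer capacities and integer budgets. -/
structure FlowNetwork (V E : Type*) where
  src : E → V
  tgt : E → V
  src_ne_tgt : ∀ e, src e ≠ tgt e
  cap : E → ℕ
  budget : V → ℤ

/-- The two usual ways to start the message passing: all messages are zero, or the message
sent by an edge is the cost function of that edge. -/
inductive BPInit
  | zero
  | edgeCost

namespace FlowNetwork

variable {V E : Type*} [Fintype E] [DecidableEq V] [DecidableEq E]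

/-- `E_v`, the set of edges incident to `v`. -/
def incident (G : FlowNetwork V E) (v : V) : Finset E :=
  Finset.univ.filter fun e => G.src e = v ∨ G.tgt e = v

/-- `Δ(v, e)`: `1` if `e` leaves `v` and `-1` if `e` enters `v`
(and `0` if `e` is not incident to `v`). -/
def sign (G : FlowNetwork V E) (v : V) (e : E) : ℝ :=
  if G.src e = v then 1 else if G.tgt e = v then -1 else 0

/-- The budget constraint at the node `v`. -/
def BudgetAt (G : FlowNetwork V E) (v : V) (f : E → ℝ) : Prop :=
  ∑ e ∈ G.incident v, G.sign v e * f e = (G.budget v : ℝ)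

/-- Feasible (real-valued) flows. -/
def IsFlow (G : FlowNetwork V E) (f : E → ℝ) : Prop :=
  (∀ e, 0 ≤ f e ∧ f e ≤ (G.cap e : ℝ)) ∧ ∀ v, G.BudgetAt v f

/-- `f` is a feasible flow of minimum cost with respect to the edge costs `c`. -/
def IsMinCostFlow (G : FlowNetwork V E) (c : E → ℝ) (f : E → ℝ) : Prop :=
  G.IsFlow f ∧ ∀ g, G.IsFlow g → ∑ e, c e * f e ≤ ∑ e, c e * g e

open Classical in
/-- The edge factor: `c_e z` if `0 ≤ z ≤ u_e`, and `+∞` otherwise. -/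
noncomputable def edgeFactor (G : FlowNetwork V E) (c : E → ℝ) (e : E) (z : ℝ) : EReal :=
  if 0 ≤ z ∧ z ≤ (G.cap e : ℝ) then ((c e * z : ℝ) : EReal) else ⊤

open Classical in
/-- The node factor: `0` if the budget constraint at `v` holds, and `+∞` otherwise.
It depends only on the values of `zbar` on the edges incident to `v`. -/
noncomputable def nodeFactor (G : FlowNetwork V E) (v : V) (zbar : E → ℝ) : EReal :=
  if G.BudgetAt v zbar then 0 else ⊤

/-- The endpoint of `e` different from its endpoint `v`. -/
def otherEnd (G : FlowNetwork V E) (e : E) (v : V) : V :=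
  if v = G.src e then G.tgt e else G.src e

/-- The message function `m^t_{e → v}` of max-product (in logarithmic form: min-sum) belief
propagation, for an endpoint `v` of `e`. With `w` the other endpoint of `e`, the update is
`m^{t+1}_{e → v}(z) =
  φ_e(z) + inf_{zbar, zbar_e = z} (ψ_w(zbar) + ∑_{e' ∈ E_w, e' ≠ e} m^t_{e' → w}(zbar_{e'}))`.
-/
noncomputable def message (G : FlowNetwork V E) (c : E → ℝ) (init : BPInit) :
    ℕ → E → V → ℝ → EReal
  | 0, e, _, z =>
    match init with
    | .zero => 0
    | .edgeCost => G.edgeFactor c e z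
  | t + 1, e, v, z =>
    G.edgeFactor c e z +
      ⨅ (zbar : E → ℝ) (_ : zbar e = z),
        (G.nodeFactor (G.otherEnd e v) zbar +
          ∑ e' ∈ (G.incident (G.otherEnd e v)).erase e,
            message G c init t e' (G.otherEnd e v) (zbar e'))

open Classical in
/-- The belief of the edge `e = (v, w)` after `t` iterations,
`m^t_{e → v}(z) + m^t_{e → w}(z) - φ_e(z)`; it is `+∞` where the edge factor is `+∞`. -/
noncomputable def belief (G : FlowNetwork V E) (c : E → ℝ) (init : BPInit)
    (t : ℕ) (e : E) (z : ℝ) : EReal :=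
  if 0 ≤ z ∧ z ≤ (G.cap e : ℝ) then
    G.message c init t e (G.src e) z + G.message c init t e (G.tgt e) z - G.edgeFactor c e z
  else ⊤

/-- After `t` iterations the belief estimate (the minimizer of the belief, edge by edge) is
well defined and is the flow `x`: each `x e` is the one and only minimizer of the belief of `e`. -/
def EstimateIs (G : FlowNetwork V E) (c : E → ℝ) (init : BPInit) (t : ℕ) (x : E → ℝ) : Prop :=
  ∀ e z, (∀ z', G.belief c init t e z ≤ G.belief c init t e z') ↔ z = x e

/-- From iteration `N` on, the belief estimate always is a min-cost flow `x`. -/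
def ConvergedAt (G : FlowNetwork V E) (c : E → ℝ) (init : BPInit) (N : ℕ) : Prop :=
  ∃ x, G.IsMinCostFlow c x ∧ ∀ t, N ≤ t → G.EstimateIs c init t x

/-- The number `τ` of iterations until belief propagation converges: the least `N ≥ 1` such that
it has converged at iteration `N`, and `∞` if there is none. -/
noncomputable def iterations (G : FlowNetwork V E) (c : E → ℝ) (init : BPInit) : ℕ∞ :=
  ⨅ (N : ℕ) (_ : 1 ≤ N ∧ G.ConvergedAt c init N), (N : ℕ∞)

end FlowNetwork

/-- The random costs `c e` are independent and `c e` has the probability density `f e` on `[0,1]`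
(with respect to Lebesgue measure), where every `f e` maps `[0,1]` to `[0,φ]`. -/
structure IsSmoothedCost {Ω E : Type*} [MeasurableSpace Ω] (P : Measure Ω) (φ : ℝ)
    (f : E → ℝ → ℝ) (c : E → Ω → ℝ) : Prop where
  density_measurable : ∀ e, Measurable (f e)
  density_mem : ∀ e, ∀ x ∈ Icc (0 : ℝ) 1, f e x ∈ Icc 0 φ
  cost_measurable : ∀ e, Measurable (c e)
  law : ∀ e, P.map (c e) =
    (volume.restrict (Icc (0 : ℝ) 1)).withDensity fun x => ENNReal.ofReal (f e x)
  indep : iIndepFun c P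

namespace FlowNetwork

/-! The proof separates a deterministic statement from a probabilistic one. The link is a gap `ε`
(`HasGap`): whenever an optimal flow `x` has an edge at capacity bound `0` or `u_e`, moving that
edge away from the bound costs at least `ε` per unit.

Deterministic part. A gap forces every simple cycle of the residual graph of an optimal `x` to cost
at least `ε` (`HasGap.le_cost`). Take potentials in `[-n, 0]` with complementary slackness
(`IsMinCostFlow.exists_potential`): the cost of a cycle is then the sum of the absolute reduced
costs on it. A non-backtracking residual walk contains a simple cycle in each window of `n` edges,
so `k * n` edges have total absolute reduced cost at least `k * ε` (`IsWalk.mul_gap_le`). Now let a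
message have argument `z ≠ x e`. At each node the excess `z - x e` has to continue on other edges,
so after `t` iterations it has been spread over non-backtracking residual walks of length `t`, and
undoing it saves their cost up to boundary terms of order `n` (`message_descent`). Once this saving
beats the boundary terms, `x e` is the unique minimizer of the belief (`belief_lt`). Hence `O(n² /
ε)` iterations suffice.

Probabilistic part, an isolation lemma. Fix an edge, one of its two bounds and all other costs. The
values of the cost of this edge for which the gap fails there lie within distance `ε` of each other,
which has probability at most `φ ε`. A union bound over edges and bounds gives failure probability
at most `2 m φ ε` (`measure_not_hasGap_le`). The theorem follows with `ε = 8 n² / t`. -/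

theorem exists_walk_repeat {V : Type*} [Fintype V] (w : ℕ → V) (j : ℕ) :
    ∃ i k, j ≤ i ∧ i < k ∧ k ≤ j + Fintype.card V ∧ w i = w k := by
  obtain ⟨p, q, hpq, h⟩ := Fintype.exists_ne_map_eq_of_card_lt
    (fun i : Fin (Fintype.card V + 1) => w (j + i)) (by simp)
  rcases lt_or_gt_of_ne hpq with h1 | h1
  · exact ⟨j + p, j + q, by omega, by simpa using h1, by omega, h⟩
  · exact ⟨j + q, j + p, by omega, by simpa using h1, by omega, h.symm⟩

/-- A walk does not use the same edge twice in a row. -/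
def NonBacktracking {E : Type*} (L : ℕ) (a : ℕ → E) : Prop :=
  ∀ i, i + 1 < L → a (i + 1) ≠ a i

/-! ### Incidence signs, residual arcs and reduced costs -/

section Signs

variable {V E : Type*} [DecidableEq V]

@[simp] theorem sign_src (G : FlowNetwork V E) (e : E) : G.sign (G.src e) e = 1 := by
  simp [sign]

@[simp] theorem sign_tgt (G : FlowNetwork V E) (e : E) : G.sign (G.tgt e) e = -1 := by
  simp [sign, G.src_ne_tgt e]

@[simp] theorem otherEnd_src (G : FlowNetwork V E) (e : E) : G.otherEnd e (G.src e) = G.tgt e := by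
  simp [otherEnd]

@[simp] theorem otherEnd_tgt (G : FlowNetwork V E) (e : E) : G.otherEnd e (G.tgt e) = G.src e := by
  simp [otherEnd, (G.src_ne_tgt e).symm]

/-- `v` is one of the two endpoints of `e`. -/
def IsEnd (G : FlowNetwork V E) (e : E) (v : V) : Prop :=
  v = G.src e ∨ v = G.tgt e

/-- A unit sent through `e` from `v` has divergence `+1` at `v` and `-1` at the other end; in this
form it telescopes along a walk. -/
theorem sign_mul_sign (G : FlowNetwork V E) {e : E} {v : V} (hv : G.IsEnd e v) (u : V) :
    G.sign v e * G.sign u e =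
      (if u = v then 1 else 0) - (if u = G.otherEnd e v then 1 else 0) := by
  have h := G.src_ne_tgt e
  rcases hv with rfl | rfl
  · by_cases h1 : u = G.src e
    · subst h1; simp [h]
    · by_cases h2 : u = G.tgt e
      · subst h2; simp [h.symm]
      · simp [sign, h1, h2, Ne.symm h1, Ne.symm h2]
  · by_cases h1 : u = G.src e
    · subst h1; simp [h]
    · by_cases h2 : u = G.tgt e
      · subst h2; simp [h.symm]
      · simp [sign, h1, h2, Ne.symm h1, Ne.symm h2]

theorem sign_eq_one_or (G : FlowNetwork V E) {e : E} {v : V} (hv : G.IsEnd e v) :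
    G.sign v e = 1 ∨ G.sign v e = -1 := by
  rcases hv with rfl | rfl <;> simp

theorem isEnd_otherEnd (G : FlowNetwork V E) {e : E} {v : V} (hv : G.IsEnd e v) :
    G.IsEnd e (G.otherEnd e v) := by
  rcases hv with rfl | rfl <;> simp [IsEnd]

theorem sign_otherEnd (G : FlowNetwork V E) {e : E} {v : V} (hv : G.IsEnd e v) :
    G.sign (G.otherEnd e v) e = -G.sign v e := by
  rcases hv with rfl | rfl <;> simp

theorem eq_or_eq_otherEnd (G : FlowNetwork V E) {e : E} {v u : V} (hv : G.IsEnd e v)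
    (hu : G.IsEnd e u) : u = v ∨ u = G.otherEnd e v := by
  rcases hv with rfl | rfl <;> rcases hu with rfl | rfl <;> simp

/-- The edge `e` can carry excess flow away from its endpoint `v` (if `s = 1`), or towards it
(if `s = -1`), on top of the flow `x`. -/
def Residual (G : FlowNetwork V E) (s : ℝ) (x : E → ℝ) (e : E) (v : V) : Prop :=
  G.IsEnd e v ∧ (0 < s * G.sign v e → x e < G.cap e) ∧ (s * G.sign v e < 0 → 0 < x e)

/-- The nodes `w` and edges `a` form a walk with `L` edges in the residual graph. -/
def IsWalk (G : FlowNetwork V E) (s : ℝ) (x : E → ℝ) (L : ℕ) (w : ℕ → V) (a : ℕ → E) : Prop :=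
  ∀ i < L, G.Residual s x (a i) (w i) ∧ G.otherEnd (a i) (w i) = w (i + 1)

/-- Node potentials of an optimal flow `x`: the reduced costs satisfy complementary slackness. -/
structure IsPotential (G : FlowNetwork V E) (c x : E → ℝ) (π : V → ℝ) (r : E → ℝ) : Prop where
  reduced : ∀ e, r e = c e + π (G.src e) - π (G.tgt e)
  nonneg : ∀ e, x e < G.cap e → 0 ≤ r e
  nonpos : ∀ e, 0 < x e → r e ≤ 0

/-- The cost of a residual arc is its reduced cost plus the difference of the potentials. -/
theorem IsPotential.sign_mul_cost {G : FlowNetwork V E} {c x : E → ℝ} {π : V → ℝ} {r : E → ℝ}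
    (hπ : G.IsPotential c x π r) {e : E} {v : V} (hv : G.IsEnd e v) :
    G.sign v e * c e = G.sign v e * r e - π v + π (G.otherEnd e v) := by
  rcases hv with rfl | rfl <;> simp only [hπ.reduced e, sign_src, sign_tgt, otherEnd_src,
    otherEnd_tgt] <;> ring

/-- Complementary slackness makes the reduced cost nonnegative in the direction in which an arc is
residual, so signed sums along walks become sums of absolute values. -/
theorem IsPotential.abs_reduced {G : FlowNetwork V E} {c x : E → ℝ} {π : V → ℝ} {r : E → ℝ}
    (hπ : G.IsPotential c x π r) {s : ℝ} (hs : s = 1 ∨ s = -1) {e : E} {v : V}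
    (hres : G.Residual s x e v) : s * G.sign v e * r e = |r e| := by
  have h : s * G.sign v e = 1 ∨ s * G.sign v e = -1 := by
    rcases hs with rfl | rfl <;> rcases G.sign_eq_one_or hres.1 with h | h <;> simp [h]
  rcases h with h | h
  · rw [h, one_mul, abs_of_nonneg (hπ.nonneg e (hres.2.1 (by rw [h]; norm_num)))]
  · rw [h, abs_of_nonpos (hπ.nonpos e (hres.2.2 (by rw [h]; norm_num)))]; ring

end Signs

/-! ### Augmenting circulations and the gap -/

section Flows

variable {V E : Type*} [Fintype E] [DecidableEq V]

theorem mem_incident (G : FlowNetwork V E) {e : E} {v : V} : e ∈ G.incident v ↔ G.IsEnd e v := by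
  simp [incident, IsEnd, eq_comm]

theorem sum_incident (G : FlowNetwork V E) (v : V) (f : E → ℝ) :
    ∑ e ∈ G.incident v, G.sign v e * f e = ∑ e, G.sign v e * f e := by
  refine Finset.sum_subset (Finset.subset_univ _) fun e _ he => ?_
  have : ¬ (G.src e = v ∨ G.tgt e = v) := by simpa [incident] using he
  push Not at this
  simp [sign, this.1, this.2]

/-- A vector with zero net flow at every node. -/
def IsCirculation (G : FlowNetwork V E) (h : E → ℝ) : Prop :=
  ∀ v, ∑ e, G.sign v e * h e = 0

/-- `h` is a circulation along which a little flow can be added to `x` without violating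
the capacities. -/
structure IsAugmenting (G : FlowNetwork V E) (x h : E → ℝ) : Prop where
  circulation : G.IsCirculation h
  lt_cap : ∀ e, 0 < h e → x e < G.cap e
  pos : ∀ e, h e < 0 → 0 < x e

theorem IsFlow.budget_add {G : FlowNetwork V E} {x h : E → ℝ} (hx : G.IsFlow x)
    (hh : G.IsCirculation h) (η : ℝ) (v : V) : G.BudgetAt v fun e => x e + η * h e := by
  have h1 := hx.2 v
  have h2 := hh v
  unfold BudgetAt at *
  rw [sum_incident] at *
  simp only [mul_add, Finset.sum_add_distrib]
  rw [h1]
  have : ∑ e, G.sign v e * (η * h e) = η * ∑ e, G.sign v e * h e := by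
    rw [Finset.mul_sum]; exact Finset.sum_congr rfl fun e _ => by ring
  rw [this, h2]; simp

theorem sum_cost_add (c x h : E → ℝ) (η : ℝ) :
    ∑ e, c e * (x e + η * h e) = ∑ e, c e * x e + η * ∑ e, c e * h e := by
  rw [Finset.mul_sum, ← Finset.sum_add_distrib]
  exact Finset.sum_congr rfl fun e _ => by ring

/-- Adding flow along an augmenting circulation until an edge becomes empty or saturated. -/
theorem IsAugmenting.exists_max_step {G : FlowNetwork V E} {x h : E → ℝ} (hx : G.IsFlow x)
    (hh : G.IsAugmenting x h) (h0 : h ≠ 0) :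
    ∃ η > 0, G.IsFlow (fun e => x e + η * h e) ∧ ∃ e, h e ≠ 0 ∧
      (x e + η * h e = 0 ∨ x e + η * h e = G.cap e) := by
  classical
  let ρ : E → ℝ := fun e => if 0 < h e then (G.cap e - x e) / h e else x e / (-h e)
  have hne : (Finset.univ.filter fun e => h e ≠ 0).Nonempty := by
    obtain ⟨e, he⟩ := Function.ne_iff.1 h0
    exact ⟨e, by simpa using he⟩
  obtain ⟨e₀, he₀, hmin⟩ := Finset.exists_min_image _ ρ hne
  have he₀' : h e₀ ≠ 0 := by simpa using he₀
  have hρ : 0 < ρ e₀ := by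
    rcases lt_or_gt_of_ne he₀' with hn | hp
    · have := hh.pos e₀ hn
      simp only [ρ, not_lt.2 hn.le, if_false]
      exact div_pos this (by linarith)
    · have := hh.lt_cap e₀ hp
      simp only [ρ, hp, if_true]
      exact div_pos (by linarith) hp
  refine ⟨ρ e₀, hρ, ⟨fun e => ?_, hx.budget_add hh.circulation _⟩, e₀, he₀', ?_⟩
  · obtain ⟨h1, h2⟩ := hx.1 e
    rcases lt_trichotomy (h e) 0 with hn | hz | hp
    · have := hmin e (by simp [hn.ne])
      have h3 : ρ e = x e / (-h e) := by simp [ρ, not_lt.2 hn.le]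
      rw [h3, le_div_iff₀ (by linarith)] at this
      have := mul_neg_of_pos_of_neg hρ hn
      constructor <;> linarith
    · simp [hz, h1, h2]
    · have := hmin e (by simp [hp.ne'])
      have h3 : ρ e = (G.cap e - x e) / h e := by simp [ρ, hp]
      rw [h3, le_div_iff₀ hp] at this
      have := mul_pos hρ hp
      constructor <;> linarith
  · rcases lt_or_gt_of_ne he₀' with hn | hp
    · left
      simp only [ρ, not_lt.2 hn.le, if_false]
      field_simp; ring
    · right
      simp only [ρ, hp, if_true]
      field_simp; ring

/-- Optimality: augmenting circulations have nonnegative cost. -/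
theorem IsMinCostFlow.cost_nonneg {G : FlowNetwork V E} {c x h : E → ℝ}
    (hx : G.IsMinCostFlow c x) (hh : G.IsAugmenting x h) : 0 ≤ ∑ e, c e * h e := by
  by_cases h0 : h = 0
  · simp [h0]
  obtain ⟨η, hη, hf, -⟩ := hh.exists_max_step hx.1 h0
  have := hx.2 _ hf
  rw [sum_cost_add] at this
  exact nonneg_of_mul_nonneg_right (by linarith) hη

/-- Every flow costs at least `ε` per unit by which it moves an edge away from the value `0` or
`u_e` that this edge has in an optimal flow. -/
def HasGap (G : FlowNetwork V E) (c : E → ℝ) (ε : ℝ) : Prop :=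
  ∀ x, G.IsMinCostFlow c x → ∀ e, (x e = 0 ∨ x e = G.cap e) → ∀ g, G.IsFlow g →
    ε * |g e - x e| ≤ ∑ e, c e * g e - ∑ e, c e * x e

/-- If `h` uses an edge at a bound of `x`, the gap at that edge applies to a flow `x + η h`.
Otherwise `h` and `-h` are both augmenting, so `h` is free, and the gap is violated at another
optimal flow. -/
theorem HasGap.le_cost {G : FlowNetwork V E} {c x h : E → ℝ} {ε : ℝ} (hG : G.HasGap c ε)
    (hε : 0 < ε) (hx : G.IsMinCostFlow c x) (hh : G.IsAugmenting x h) (h0 : h ≠ 0)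
    (hint : ∀ e, h e ≠ 0 → 1 ≤ |h e|) : ε ≤ ∑ e, c e * h e := by
  obtain ⟨η, hη, hf, e₁, he₁, hb⟩ := hh.exists_max_step hx.1 h0
  have hcost := sum_cost_add c x h η
  by_contra! hlt
  by_cases hex : ∃ e, h e ≠ 0 ∧ (x e = 0 ∨ x e = G.cap e)
  · obtain ⟨e, he, hxe⟩ := hex
    have := hG x hx e hxe _ hf
    rw [hcost, add_sub_cancel_left, add_sub_cancel_left, abs_mul, abs_of_pos hη] at this
    have h1 : ε * (η * 1) ≤ ε * (η * |h e|) := by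
      gcongr; exact hint e he
    nlinarith
  -- Going along the free `h` until an edge `e₁` hits a bound gives a new optimal flow. From there,
  -- `x` is a flow of the same cost that moves `e₁` off its bound.
  · push Not at hex
    have hneg : G.IsAugmenting x (-h) := by
      refine ⟨fun v => ?_, fun e he => ?_, fun e he => ?_⟩
      · simpa using hh.circulation v
      · have := hex e (by rintro h; simp [h] at he)
        exact lt_of_le_of_ne (hx.1.1 e).2 this.2
      · have := hex e (by rintro h; simp [h] at he)
        exact lt_of_le_of_ne (hx.1.1 e).1 (Ne.symm this.1)
    have hc0 : ∑ e, c e * h e = 0 := by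
      have h1 := hx.cost_nonneg hh
      have h2 := hx.cost_nonneg hneg
      simp only [Pi.neg_apply, mul_neg, Finset.sum_neg_distrib] at h2
      linarith
    rw [hc0, mul_zero, add_zero] at hcost
    have hopt : G.IsMinCostFlow c fun e => x e + η * h e :=
      ⟨hf, fun g hg => by rw [hcost]; exact hx.2 g hg⟩
    have := hG _ hopt e₁ hb x hx.1
    rw [hcost, sub_self] at this
    have h2 : 0 < |x e₁ - (x e₁ + η * h e₁)| := by
      rw [abs_pos]; simp [hη.ne', he₁]
    exact absurd this (not_le.2 (mul_pos hε h2))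

theorem IsPotential.circulation_cost [Fintype V] {G : FlowNetwork V E} {c x : E → ℝ} {π : V → ℝ}
    {r : E → ℝ} (hπ : G.IsPotential c x π r) {h : E → ℝ} (hh : G.IsCirculation h) :
    ∑ e, c e * h e = ∑ e, r e * h e := by
  have h1 : ∀ e, ∑ v, π v * G.sign v e = π (G.src e) - π (G.tgt e) := by
    intro e
    have : ∀ v, π v * G.sign v e =
        (if v = G.src e then π v else 0) - (if v = G.tgt e then π v else 0) := by
      intro v
      by_cases h1 : v = G.src e
      · subst h1; simp [G.src_ne_tgt e]
      · by_cases h2 : v = G.tgt e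
        · subst h2; simp [(G.src_ne_tgt e).symm]
        · simp [sign, h1, h2, Ne.symm h1, Ne.symm h2]
    simp [this, Finset.sum_sub_distrib]
  have h2 : ∑ e, (π (G.src e) - π (G.tgt e)) * h e = 0 := by
    simp_rw [← h1, Finset.sum_mul]
    rw [Finset.sum_comm]
    refine Finset.sum_eq_zero fun v _ => ?_
    simp_rw [mul_assoc]
    rw [← Finset.mul_sum, hh v, mul_zero]
  have h3 : ∀ e, r e * h e = c e * h e + (π (G.src e) - π (G.tgt e)) * h e := by
    intro e; rw [hπ.reduced e]; ring
  simp [h3, Finset.sum_add_distrib, h2]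

/-! ### Residual walks, potentials and the cost of long walks -/

section Walks

variable [DecidableEq E]

/-- The flow that the part of a walk between the times `i` and `k` carries. -/
def walkFlow (G : FlowNetwork V E) (s : ℝ) (w : ℕ → V) (a : ℕ → E) (i k : ℕ) (e : E) : ℝ :=
  ∑ l ∈ Finset.Ico i k, if a l = e then s * G.sign (w l) (a l) else 0

theorem sum_mul_walkFlow (G : FlowNetwork V E) (s : ℝ) (w : ℕ → V) (a : ℕ → E) (i k : ℕ)
    (c : E → ℝ) : ∑ e, c e * G.walkFlow s w a i k e =
      ∑ l ∈ Finset.Ico i k, s * G.sign (w l) (a l) * c (a l) := by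
  simp only [walkFlow, Finset.mul_sum]
  rw [Finset.sum_comm]
  refine Finset.sum_congr rfl fun l _ => ?_
  simp [mul_comm]

/-- Divergences telescope over a closed part of the walk. Where the net flow on an edge is positive
(negative), some step crosses the edge in that direction, and this step supplies the residual
condition. -/
theorem IsWalk.isAugmenting {G : FlowNetwork V E} {s : ℝ} {x : E → ℝ} {L : ℕ} {w : ℕ → V}
    {a : ℕ → E} (h : G.IsWalk s x L w a) {i k : ℕ} (hik : i ≤ k) (hk : k ≤ L) (hw : w i = w k) :
    G.IsAugmenting x (G.walkFlow s w a i k) := by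
  refine ⟨fun v => ?_, fun e he => ?_, fun e he => ?_⟩
  · rw [sum_mul_walkFlow]
    let f : ℕ → ℝ := fun j => s * -(if v = w j then (1 : ℝ) else 0)
    have : ∀ l ∈ Finset.Ico i k, s * G.sign (w l) (a l) * G.sign v (a l) = f (l + 1) - f l := by
      intro l hl
      obtain ⟨h1, h2⟩ := h l ((Finset.mem_Ico.1 hl).2.trans_le hk)
      simp only [f]
      rw [mul_assoc, G.sign_mul_sign h1.1, h2]
      ring
    rw [Finset.sum_congr rfl this, Finset.sum_Ico_sub f hik]
    simp [f, hw]
  · obtain ⟨l, hl, hpos⟩ := Finset.exists_lt_of_sum_lt (f := fun _ => (0 : ℝ))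
      (by simpa [walkFlow] using he)
    split_ifs at hpos with hle
    · subst hle
      exact (h l ((Finset.mem_Ico.1 hl).2.trans_le hk)).1.2.1 hpos
    · exact absurd hpos (lt_irrefl _)
  · obtain ⟨l, hl, hneg⟩ := Finset.exists_lt_of_sum_lt (g := fun _ => (0 : ℝ))
      (by simpa [walkFlow] using he)
    split_ifs at hneg with hle
    · subst hle
      exact (h l ((Finset.mem_Ico.1 hl).2.trans_le hk)).1.2.2 hneg
    · exact absurd hneg (lt_irrefl _)

/-- Walks in the residual graph of an optimal flow have cost at least `-n`. -/
theorem IsMinCostFlow.neg_card_le_walk_cost [Fintype V] {G : FlowNetwork V E} {c x : E → ℝ}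
    (hx : G.IsMinCostFlow c x) (hc : ∀ e, c e ∈ Icc (0 : ℝ) 1) (L : ℕ) :
    ∀ (w : ℕ → V) (a : ℕ → E), G.IsWalk 1 x L w a →
      -(Fintype.card V : ℝ) ≤ ∑ l ∈ Finset.range L, G.sign (w l) (a l) * c (a l) := by
  induction L using Nat.strong_induction_on with
  | _ L ih =>
  intro w a hwa
  by_cases hL : L ≤ Fintype.card V
  · have : ∑ l ∈ Finset.range L, (-1 : ℝ) ≤
        ∑ l ∈ Finset.range L, G.sign (w l) (a l) * c (a l) := by
      refine Finset.sum_le_sum fun l hl => ?_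
      obtain ⟨h1, h2⟩ := hc (a l)
      rcases G.sign_eq_one_or (hwa l (Finset.mem_range.1 hl)).1.1 with h | h <;> rw [h] <;>
        linarith
    have hL' : (L : ℝ) ≤ Fintype.card V := by exact_mod_cast hL
    simp at this
    linarith
  · obtain ⟨i, k, -, hik, hk, hw⟩ := exists_walk_repeat w 0
    have hkL : k ≤ L := by omega
    -- Index map that cuts out the closed part from `i` to `k`, whose cost is nonnegative by
    -- optimality.
    let g : ℕ → ℕ := fun l => if l < i then l else l + (k - i)
    have hg := ih (L - (k - i)) (by omega) (w ∘ g) (a ∘ g) (by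
      intro l hl
      by_cases hli : l < i
      · have h1 := hwa l (by omega)
        have h2 : w (g (l + 1)) = w (l + 1) := by
          by_cases h3 : l + 1 < i
          · simp [g, h3]
          · have h4 : l + 1 = i := by omega
            have h5 : g (l + 1) = k := by simp only [g, h4, lt_irrefl, if_false]; omega
            rw [h5, h4, hw]
        simpa [g, hli, h2] using h1
      · have h1 := hwa (l + (k - i)) (by omega)
        have h3 : ¬ l + 1 < i := by omega
        have h4 : l + (k - i) + 1 = l + 1 + (k - i) := by omega
        simpa [g, hli, h3, ← h4] using h1)
    have hcyc := hx.cost_nonneg (hwa.isAugmenting hik.le hkL hw)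
    rw [sum_mul_walkFlow] at hcyc
    simp only [one_mul] at hcyc
    set F : ℕ → ℝ := fun l => G.sign (w l) (a l) * c (a l) with hF
    have hs1 : ∑ l ∈ Finset.range (L - (k - i)), G.sign ((w ∘ g) l) ((a ∘ g) l) * c ((a ∘ g) l) =
        ∑ l ∈ Finset.range i, F l + ∑ l ∈ Finset.Ico k L, F l := by
      rw [← Finset.sum_range_add_sum_Ico _ (show i ≤ L - (k - i) by omega)]
      congr 1
      · refine Finset.sum_congr rfl fun l hl => ?_
        simp [g, Finset.mem_range.1 hl, hF]
      · have h1 : Finset.Ico k L = Finset.Ico (i + (k - i)) (L - (k - i) + (k - i)) := by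
          congr 1 <;> omega
        rw [h1, ← Finset.sum_Ico_add' F]
        refine Finset.sum_congr rfl fun l hl => ?_
        simp [g, not_lt.2 (Finset.mem_Ico.1 hl).1, hF]
    have hs2 : ∑ l ∈ Finset.range L, F l =
        ∑ l ∈ Finset.range i, F l + ∑ l ∈ Finset.Ico i k, F l + ∑ l ∈ Finset.Ico k L, F l := by
      rw [Finset.sum_range_add_sum_Ico _ hik.le, Finset.sum_range_add_sum_Ico _ hkL]
    rw [hs1] at hg
    rw [hs2]
    linarith

/-- `π v` is the infimum of the costs of residual walks ending at `v`, the empty walk included.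
Appending a residual arc to a walk gives the sign conditions on the reduced costs. -/
theorem IsMinCostFlow.exists_potential [Fintype V] {G : FlowNetwork V E} {c x : E → ℝ}
    (hx : G.IsMinCostFlow c x) (hc : ∀ e, c e ∈ Icc (0 : ℝ) 1) :
    ∃ π r, G.IsPotential c x π r ∧ ∀ v, π v ∈ Icc (-(Fintype.card V : ℝ)) 0 := by
  let S : V → Set ℝ := fun v => {y | ∃ (L : ℕ) (w : ℕ → V) (a : ℕ → E), G.IsWalk 1 x L w a ∧
    w L = v ∧ y = ∑ l ∈ Finset.range L, G.sign (w l) (a l) * c (a l)}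
  have hbdd : ∀ v, ∀ y ∈ S v, -(Fintype.card V : ℝ) ≤ y := by
    rintro v y ⟨L, w, a, h, -, rfl⟩
    exact hx.neg_card_le_walk_cost hc L w a h
  have step : ∀ e u, G.Residual 1 x e u →
      sInf (S (G.otherEnd e u)) ≤ sInf (S u) + G.sign u e * c e := by
    intro e u hres
    have h0 : (S u).Nonempty := ⟨0, 0, fun _ => u, fun _ => e, by simp [IsWalk]⟩
    rw [← sub_le_iff_le_add]
    refine le_csInf h0 ?_
    rintro y ⟨L, w, a, h, hL, rfl⟩
    rw [sub_le_iff_le_add]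
    refine csInf_le ⟨_, hbdd _⟩ ⟨L + 1, Function.update w (L + 1) (G.otherEnd e u),
      Function.update a L e, ?_, by simp, ?_⟩
    · intro i hi
      rcases Nat.lt_succ_iff_lt_or_eq.1 hi with h1 | rfl
      · have h2 : i ≠ L := h1.ne
        have h3 : i ≠ L + 1 := by omega
        simpa [h2, h3] using h i h1
      · simpa [hL] using hres
    · rw [Finset.sum_range_succ]
      congr 1
      · refine Finset.sum_congr rfl fun l hl => ?_
        have h1 := Finset.mem_range.1 hl
        have h2 : l ≠ L := h1.ne
        have h3 : l ≠ L + 1 := by omega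
        simp [h2, h3]
      · simp [hL]
  refine ⟨fun v => sInf (S v), _, ⟨fun e => rfl, fun e he => ?_, fun e he => ?_⟩, fun v => ?_⟩
  · have := step e (G.src e) ⟨Or.inl rfl, fun _ => he, fun h => by norm_num at h⟩
    simp at this
    linarith
  · have := step e (G.tgt e) ⟨Or.inr rfl, fun h => by norm_num at h, fun _ => he⟩
    simp at this
    linarith
  · by_cases hE : Nonempty E
    · obtain ⟨e⟩ := hE
      have h0 : (0 : ℝ) ∈ S v := ⟨0, fun _ => v, fun _ => e, by simp [IsWalk]⟩
      exact ⟨le_csInf ⟨_, h0⟩ (hbdd v), csInf_le ⟨_, hbdd v⟩ h0⟩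
    -- Without edges there is no sequence `a : ℕ → E`, not even for the empty walk, and `sInf ∅ =
    -- 0`.
    · have : S v = ∅ := by
        rw [Set.eq_empty_iff_forall_notMem]
        rintro y ⟨L, w, a, -⟩
        exact hE ⟨a 0⟩
      simp [this]

/-- The `n + 1` nodes of the window repeat, and a shortest repetition bounds a cycle without
repeated edges. It has flow `±1` on its edges, so `HasGap.le_cost` applies. -/
theorem IsWalk.gap_le_window [Fintype V] {G : FlowNetwork V E} {c x : E → ℝ} {ε : ℝ}
    (hG : G.HasGap c ε) (hε : 0 < ε) (hx : G.IsMinCostFlow c x) {π : V → ℝ} {r : E → ℝ}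
    (hπ : G.IsPotential c x π r) {s : ℝ} (hs : s = 1 ∨ s = -1) {L : ℕ} {w : ℕ → V} {a : ℕ → E}
    (hw : G.IsWalk s x L w a) (ha : NonBacktracking L a) {j : ℕ}
    (hj : j + Fintype.card V ≤ L) :
    ε ≤ ∑ l ∈ Finset.Ico j (j + Fintype.card V), |r (a l)| := by
  classical
  have hex : ∃ d i, 0 < d ∧ j ≤ i ∧ i + d ≤ j + Fintype.card V ∧ w i = w (i + d) := by
    obtain ⟨i, k, h1, h2, h3, h4⟩ := exists_walk_repeat w j
    exact ⟨k - i, i, by omega, h1, by omega, by rw [show i + (k - i) = k by omega, h4]⟩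
  obtain ⟨i, hd, hji, hk, hwi⟩ := Nat.find_spec hex
  set d := Nat.find hex with hd_def
  have hdist : ∀ l l', i ≤ l → l < l' → l' < i + d → w l ≠ w l' := by
    intro l l' h1 h2 h3 h4
    refine Nat.find_min hex (m := l' - l) (by omega) ⟨l, by omega, by omega, by omega, ?_⟩
    rw [show l + (l' - l) = l' by omega, h4]
  have haug := hw.isAugmenting (show i ≤ i + d by omega) (hk.trans hj) hwi
  -- A reused edge would start at one of the two ends of its first use. This repeats a node too
  -- early, unless the two uses are consecutive, which is backtracking.
  have honce : ∀ l l', i ≤ l → l < l' → l' < i + d → a l ≠ a l' := by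
    intro l l' h1 h2 h3 h4
    obtain ⟨hl, hl1⟩ := hw l (by omega)
    obtain ⟨hl', -⟩ := hw l' (by omega)
    rw [← h4] at hl'
    rcases G.eq_or_eq_otherEnd hl.1 hl'.1 with h5 | h5
    · exact hdist l l' h1 h2 h3 h5.symm
    · rw [hl1] at h5
      rcases Nat.lt_or_ge (l + 1) l' with h6 | h6
      · exact hdist (l + 1) l' (by omega) h6 h3 h5.symm
      · have h7 : l' = l + 1 := by omega
        subst h7
        exact ha l (by omega) h4.symm
  have hval : ∀ l, i ≤ l → l < i + d →
      G.walkFlow s w a i (i + d) (a l) = s * G.sign (w l) (a l) := by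
    intro l h1 h2
    rw [walkFlow, Finset.sum_eq_single_of_mem l (Finset.mem_Ico.2 ⟨h1, h2⟩)]
    · simp
    · intro l' hl' hne
      rw [Finset.mem_Ico] at hl'
      rw [if_neg]
      rcases lt_or_gt_of_ne hne with h3 | h3
      · exact honce l' l hl'.1 h3 h2
      · exact (honce l l' h1 h3 hl'.2).symm
  have habs : ∀ l, i ≤ l → l < i + d → |s * G.sign (w l) (a l)| = 1 := by
    intro l h1 h2
    rcases hs with rfl | rfl <;>
      rcases G.sign_eq_one_or (hw l (by omega)).1.1 with h | h <;> simp [h]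
  have h0 : G.walkFlow s w a i (i + d) ≠ 0 := by
    intro h
    have h1 := hval i le_rfl (by omega)
    have h2 := habs i le_rfl (by omega)
    rw [← h1, h] at h2
    simp at h2
  have hle := hG.le_cost hε hx haug h0 (by
    intro e he
    obtain ⟨l, hl, hne⟩ := Finset.exists_ne_zero_of_sum_ne_zero he
    rw [Finset.mem_Ico] at hl
    have : a l = e := by by_contra h; simp [h] at hne
    rw [← this, hval l hl.1 hl.2, habs l hl.1 hl.2])
  rw [hπ.circulation_cost haug.circulation, sum_mul_walkFlow] at hle
  refine hle.trans ?_
  have : ∑ l ∈ Finset.Ico i (i + d), s * G.sign (w l) (a l) * r (a l) =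
      ∑ l ∈ Finset.Ico i (i + d), |r (a l)| :=
    Finset.sum_congr rfl fun l hl =>
      hπ.abs_reduced hs (hw l ((Finset.mem_Ico.1 hl).2.trans_le (hk.trans hj))).1
  rw [this]
  exact Finset.sum_le_sum_of_subset_of_nonneg (Finset.Ico_subset_Ico hji hk)
    fun _ _ _ => abs_nonneg _

theorem IsWalk.mul_gap_le [Fintype V] {G : FlowNetwork V E} {c x : E → ℝ} {ε : ℝ}
    (hG : G.HasGap c ε) (hε : 0 < ε) (hx : G.IsMinCostFlow c x) {π : V → ℝ} {r : E → ℝ}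
    (hπ : G.IsPotential c x π r) {s : ℝ} (hs : s = 1 ∨ s = -1) {L : ℕ} {w : ℕ → V} {a : ℕ → E}
    (hw : G.IsWalk s x L w a) (ha : NonBacktracking L a) {k : ℕ}
    (hk : k * Fintype.card V ≤ L) : k * ε ≤ ∑ l ∈ Finset.range L, |r (a l)| := by
  have h : k * ε ≤ ∑ l ∈ Finset.range (k * Fintype.card V), |r (a l)| := by
    induction k with
    | zero => simp
    | succ k ih =>
      rw [Nat.succ_mul] at hk ⊢
      have h1 := ih (by omega)
      have h2 := hw.gap_le_window hG hε hx hπ hs ha hk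
      rw [← Finset.sum_range_add_sum_Ico _ (Nat.le_add_right (k * Fintype.card V) _)]
      push_cast
      linarith
  exact h.trans (Finset.sum_le_sum_of_subset_of_nonneg (Finset.range_mono hk)
    fun _ _ _ => abs_nonneg _)

end Walks

end Flows

/-! ### Messages and beliefs away from the optimal flow -/

section Messages

theorem ereal_coe_sum {ι : Type*} (S : Finset ι) (f : ι → ℝ) :
    ((∑ i ∈ S, f i : ℝ) : EReal) = ∑ i ∈ S, (f i : EReal) := by
  classical
  induction S using Finset.induction_on with
  | empty => rfl
  | insert a S ha hS => rw [Finset.sum_insert ha, Finset.sum_insert ha, EReal.coe_add, hS]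

theorem edgeFactor_nonneg {V E : Type*} (G : FlowNetwork V E) {c : E → ℝ} (hc : ∀ e, c e ∈ Icc (0 : ℝ) 1)
    (e : E) (z : ℝ) : 0 ≤ G.edgeFactor c e z := by
  unfold edgeFactor
  split_ifs with h
  · exact_mod_cast mul_nonneg (hc e).1 h.1
  · exact le_top

variable {V E : Type*} [Fintype E] [DecidableEq V]

theorem nodeFactor_nonneg (G : FlowNetwork V E) (v : V) (z : E → ℝ) : 0 ≤ G.nodeFactor v z := by
  unfold nodeFactor
  split_ifs <;> simp

variable [DecidableEq E]

theorem message_nonneg (G : FlowNetwork V E) {c : E → ℝ} (hc : ∀ e, c e ∈ Icc (0 : ℝ) 1)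
    (init : BPInit) (t : ℕ) : ∀ e v z, 0 ≤ G.message c init t e v z := by
  induction t with
  | zero =>
    intro e v z
    cases init
    · exact le_rfl
    · exact G.edgeFactor_nonneg hc e z
  | succ t ih =>
    intro e v z
    exact add_nonneg (G.edgeFactor_nonneg hc e z) (le_iInf₂ fun zbar _ =>
      add_nonneg (G.nodeFactor_nonneg _ _) (Finset.sum_nonneg fun e' _ => ih _ _ _))

/-- With `message_nonneg`, this makes messages at the optimal flow real numbers, so that they can be
subtracted in `EReal`. -/
theorem message_flow_lt_top (G : FlowNetwork V E) {c x : E → ℝ} (hx : G.IsFlow x)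
    (init : BPInit) (t : ℕ) : ∀ e v, G.message c init t e v (x e) < ⊤ := by
  have hφ : ∀ e, G.edgeFactor c e (x e) < ⊤ := fun e => by
    rw [edgeFactor, if_pos (hx.1 e)]; exact EReal.coe_lt_top _
  induction t with
  | zero =>
    intro e v
    cases init
    · exact EReal.coe_lt_top 0
    · exact hφ e
  | succ t ih =>
    intro e v
    refine EReal.add_lt_top (hφ e).ne (ne_of_lt ?_)
    refine lt_of_le_of_lt (iInf_le_of_le x (iInf_le _ rfl)) ?_
    rw [nodeFactor, if_pos (hx.2 _), zero_add]
    have : ∀ S : Finset E, ∑ e' ∈ S, G.message c init t e' (G.otherEnd e v) (x e') < ⊤ := by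
      intro S
      induction S using Finset.induction_on with
      | empty => exact EReal.coe_lt_top 0
      | insert a S ha hS =>
        rw [Finset.sum_insert ha]
        exact EReal.add_lt_top (ih _ _).ne hS.ne
    exact this _

/-- Excess flow that enters a node `w` along `e` can be taken back on the other edges at `w`. -/
theorem exists_rerouting (G : FlowNetwork V E) {x z : E → ℝ} {e : E} {w : V}
    (hx : G.BudgetAt w x) (hz : G.BudgetAt w z) (he : G.IsEnd e w) {s : ℝ}
    (hs : s = 1 ∨ s = -1) {d : ℝ} (hd : 0 < d) (hdz : d ≤ -(s * G.sign w e) * (z e - x e)) :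
    ∃ δ : E → ℝ, δ e = -d ∧ (∀ e', e' ≠ e → 0 ≤ δ e') ∧
      (∀ e', e' ≠ e → δ e' ≤ s * G.sign w e' * (z e' - x e') ∨ δ e' = 0) ∧
      ∑ e' ∈ (G.incident w).erase e, δ e' = d ∧
      G.BudgetAt w fun e' => z e' - s * G.sign w e' * δ e' := by
  classical
  have hss : s * s = 1 := by rcases hs with rfl | rfl <;> norm_num
  have heI : e ∈ G.incident w := G.mem_incident.2 he
  -- `D` is the surplus leaving `w`, oriented by `s`. Positive surpluses on the other edges total at
  -- least `d`; `δ` scales them down to total exactly `d`.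
  let D : E → ℝ := fun e' => s * G.sign w e' * (z e' - x e')
  set P := ∑ e' ∈ (G.incident w).erase e, max (D e') 0 with hPdef
  have hsum : ∑ e' ∈ (G.incident w).erase e, D e' = -D e := by
    have h1 : ∑ e' ∈ G.incident w, D e' = 0 := by
      have h2 : ∑ e' ∈ G.incident w, D e' = s * (∑ e' ∈ G.incident w, G.sign w e' * z e' -
          ∑ e' ∈ G.incident w, G.sign w e' * x e') := by
        rw [← Finset.sum_sub_distrib, Finset.mul_sum]
        exact Finset.sum_congr rfl fun _ _ => by simp only [D]; ring
      unfold BudgetAt at hx hz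
      rw [h2, hx, hz, sub_self, mul_zero]
    rw [← Finset.add_sum_erase _ _ heI] at h1
    linarith
  have hDe : -D e = -(s * G.sign w e) * (z e - x e) := by simp only [D]; ring
  have hP : d ≤ P := by
    rw [← hDe, ← hsum] at hdz
    exact hdz.trans (Finset.sum_le_sum fun _ _ => le_max_left _ _)
  have hP0 : 0 < P := hd.trans_le hP
  have hdP : d / P ≤ 1 := (div_le_one hP0).2 hP
  have hdP0 : 0 ≤ d / P := by positivity
  have herase : ∑ e' ∈ (G.incident w).erase e,
      (if e' = e then -d else d / P * max (D e') 0) = d := by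
    have h : ∀ e' ∈ (G.incident w).erase e,
        (if e' = e then -d else d / P * max (D e') 0) = d / P * max (D e') 0 :=
      fun e' he' => if_neg (Finset.ne_of_mem_erase he')
    rw [Finset.sum_congr rfl h, ← Finset.mul_sum, ← hPdef]
    field_simp
  refine ⟨fun e' => if e' = e then -d else d / P * max (D e') 0, by simp, ?_, ?_, herase, ?_⟩
  · intro e' he'
    simp only [he', if_false]
    positivity
  · intro e' he'
    simp only [he', if_false]
    rcases le_total 0 (D e') with h | h
    · left
      rw [max_eq_left h]
      exact mul_le_of_le_one_left h hdP
    · right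
      rw [max_eq_right h, mul_zero]
  · unfold BudgetAt at *
    rw [← hz, ← sub_eq_zero, ← Finset.sum_sub_distrib]
    have h : ∀ e' ∈ G.incident w, G.sign w e' * (z e' - s * G.sign w e' *
        (if e' = e then -d else d / P * max (D e') 0)) - G.sign w e' * z e' =
        -s * (if e' = e then -d else d / P * max (D e') 0) := by
      intro e' he'
      have h1 : G.sign w e' * G.sign w e' = 1 := by
        rcases G.sign_eq_one_or (G.mem_incident.1 he') with h | h <;> rw [h] <;> norm_num
      linear_combination (-s * (if e' = e then -d else d / P * max (D e') 0)) * h1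
    rw [Finset.sum_congr rfl h, ← Finset.mul_sum, ← Finset.add_sum_erase _ _ heI, herase]
    simp

variable [Fintype V]

/-- Moving the argument of a message by `d` towards the value of an optimal flow saves `d` times
the cost of a long walk in the residual graph; here `B` bounds its reduced cost from below. -/
theorem message_descent {G : FlowNetwork V E} {c x : E → ℝ} (hx : G.IsFlow x)
    (hc : ∀ e, c e ∈ Icc (0 : ℝ) 1) {π : V → ℝ} {r : E → ℝ} (hπ : G.IsPotential c x π r)
    (hπn : ∀ v, π v ∈ Icc (-(Fintype.card V : ℝ)) 0) {s : ℝ} (hs : s = 1 ∨ s = -1)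
    (init : BPInit) (t : ℕ) :
    ∀ (e : E) (v : V), G.IsEnd e v → ∀ z d B : ℝ, 0 ≤ d → d ≤ s * G.sign v e * (z - x e) →
      (∀ w a, G.IsWalk s x t w a → NonBacktracking t a → w 0 = v → (0 < t → a 0 = e) →
        B ≤ ∑ l ∈ Finset.range t, |r (a l)|) →
      G.message c init t e v (z - s * G.sign v e * d) +
        ((d * (B - Fintype.card V - 1 - s * π v) : ℝ) : EReal) ≤ G.message c init t e v z := by
  have hsgn : ∀ {e v}, G.IsEnd e v → s * G.sign v e = 1 ∨ s * G.sign v e = -1 := by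
    intro e v h
    rcases hs with rfl | rfl <;> rcases G.sign_eq_one_or h with h | h <;> simp [h]
  have hcap : ∀ {e v z d}, G.IsEnd e v → 0 ≤ d → d ≤ s * G.sign v e * (z - x e) →
      0 ≤ z ∧ z ≤ G.cap e →
      0 ≤ z - s * G.sign v e * d ∧ z - s * G.sign v e * d ≤ G.cap e := by
    intro e v z d hv hd hdz hz
    have hxe := hx.1 e
    rcases hsgn hv with h | h <;> rw [h] at hdz ⊢ <;> constructor <;> linarith [hxe.1, hxe.2]
  induction t with
  | zero =>
    intro e v hv z d B hd hdz hB
    have hB0 : B ≤ 0 := by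
      simpa using hB (fun _ => v) (fun _ => e) (by simp [IsWalk]) (by simp [NonBacktracking])
        rfl (by simp)
    have hsπ : -(Fintype.card V : ℝ) ≤ s * π v := by
      obtain ⟨h1, h2⟩ := hπn v
      rcases hs with rfl | rfl <;> linarith
    -- The boundary term `n + 1` is fixed here: `n` absorbs the potential at the end of the walk,
    -- and `1` the edge cost in the initialization `edgeCost`.
    have hneg : d * (B - Fintype.card V - 1 - s * π v) ≤ -d := by nlinarith
    cases init
    · change (0 : EReal) + _ ≤ 0
      rw [zero_add]
      exact_mod_cast hneg.trans (by linarith)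
    · change G.edgeFactor c e _ + _ ≤ G.edgeFactor c e z
      by_cases hz : 0 ≤ z ∧ z ≤ G.cap e
      · rw [edgeFactor, edgeFactor, if_pos hz, if_pos (hcap hv hd hdz hz), ← EReal.coe_add,
          EReal.coe_le_coe_iff]
        obtain ⟨h1, h2⟩ := hc e
        have h3 : c e * d ≤ d := mul_le_of_le_one_left hd h2
        have h4 : 0 ≤ c e * d := mul_nonneg h1 hd
        rcases hsgn hv with h | h <;> rw [h] <;> linarith
      · rw [edgeFactor.eq_def G c e z, if_neg hz]
        exact le_top
  | succ t ih =>
    intro e v hv z d B hd hdz hB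
    rcases hd.eq_or_lt with rfl | hd0
    · simp
    have hmess : ∀ z, G.message c init (t + 1) e v z = G.edgeFactor c e z +
      ⨅ (zbar : E → ℝ) (_ : zbar e = z), (G.nodeFactor (G.otherEnd e v) zbar +
          ∑ e' ∈ (G.incident (G.otherEnd e v)).erase e,
            G.message c init t e' (G.otherEnd e v) (zbar e')) := fun _ => rfl
    rw [hmess, hmess]
    have hnn : ∀ zbar : E → ℝ, 0 ≤ ∑ e' ∈ (G.incident (G.otherEnd e v)).erase e,
            G.message c init t e' (G.otherEnd e v) (zbar e') := fun zbar =>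
      Finset.sum_nonneg fun e' _ => G.message_nonneg hc init t _ _ _
    by_cases hz : 0 ≤ z ∧ z ≤ G.cap e
    swap
    · rw [edgeFactor.eq_def G c e z, if_neg hz, EReal.top_add_of_ne_bot]
      · exact le_top
      · exact ne_of_gt (lt_of_lt_of_le (EReal.bot_lt_coe 0) (le_iInf₂ fun zbar _ =>
          add_nonneg (G.nodeFactor_nonneg _ _) (hnn zbar)))
    have hw := G.isEnd_otherEnd hv
    have hsw := G.sign_otherEnd hv
    -- Since `z` respects the capacity and lies strictly beyond `x e`, the edge has room in this
    -- direction.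
    have hres : G.Residual s x e v := by
      refine ⟨hv, fun h => ?_, fun h => ?_⟩
      · rcases hsgn hv with h1 | h1 <;> rw [h1] at h hdz <;> linarith [hz.2]
      · rcases hsgn hv with h1 | h1 <;> rw [h1] at h hdz <;> linarith [hz.1]
    have hcost := hπ.sign_mul_cost hv
    have habs := hπ.abs_reduced hs hres
    set w := G.otherEnd e v with hwdef
    have hB' : ∀ e', e' ≠ e → ∀ w' a', G.IsWalk s x t w' a' → NonBacktracking t a' → w' 0 = w →
        (0 < t → a' 0 = e') → B - |r e| ≤ ∑ l ∈ Finset.range t, |r (a' l)| := by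
      intro e' he' w' a' h1 h2 h3 h4
      -- Prepend `e` to the walk from `w`; it stays non-backtracking because `e' ≠ e`.
      have := hB (fun i => Nat.casesOn i v w') (fun i => Nat.casesOn i e a') ?_ ?_ rfl
        fun _ => rfl
      · rw [Finset.sum_range_succ'] at this
        simpa [sub_le_iff_le_add] using this
      · rintro (_ | i) hi
        · exact ⟨hres, h3.symm⟩
        · exact h1 i (by omega)
      · rintro (_ | i) hi
        · change a' 0 ≠ e
          rw [h4 (by omega)]
          exact he'
        · exact h2 i (by omega)
    -- `K` is the saving left for the messages into `w`: crossing `e` uses up `|r e|` and exchanges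
    -- the potential at `v` for that at `w`.
    set K := d * (B - |r e| - Fintype.card V - 1 - s * π w) with hK
    have hKeq : c e * (z - s * G.sign v e * d) + d * (B - Fintype.card V - 1 - s * π v) =
        c e * z + K := by
      rw [hK]
      linear_combination (-(s * d)) * hcost - d * habs
    rw [edgeFactor, edgeFactor, if_pos hz, if_pos (hcap hv hd hdz hz), add_right_comm,
      ← EReal.coe_add, hKeq, EReal.coe_add, add_assoc]
    refine add_le_add le_rfl (le_iInf₂ fun zbar hzbar => ?_)
    by_cases hbud : G.BudgetAt w zbar
    swap
    · rw [nodeFactor.eq_def G w zbar, if_neg hbud, EReal.top_add_of_ne_bot]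
      · exact le_top
      · exact ne_of_gt (lt_of_lt_of_le (EReal.bot_lt_coe 0) (hnn zbar))
    rw [nodeFactor.eq_def G w zbar, if_pos hbud, zero_add]
    obtain ⟨δ, hδe, hδ0, hδD, hδsum, hδbud⟩ := G.exists_rerouting (hx.2 w) hbud hw hs hd0
      (by rw [hzbar, hsw]; simpa using hdz)
    have hinf := iInf₂_le (f := fun (zb : E → ℝ) (_ : zb e = z - s * G.sign v e * d) =>
      G.nodeFactor w zb + ∑ e' ∈ (G.incident w).erase e, G.message c init t e' w (zb e'))
      (fun e' => zbar e' - s * G.sign w e' * δ e') (by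
        simp only [hδe, hsw, hzbar]; ring)
    rw [nodeFactor.eq_def G w, if_pos hδbud, zero_add] at hinf
    refine (add_le_add le_rfl hinf).trans ?_
    -- As `δ` has total `d`, the saving splits over the edges `e'`, each covered by the induction
    -- hypothesis with excess `δ e'`.
    have hKsum : (K : EReal) = ∑ e' ∈ (G.incident w).erase e,
        ((δ e' * (B - |r e| - Fintype.card V - 1 - s * π w) : ℝ) : EReal) := by
      rw [← ereal_coe_sum, ← Finset.sum_mul, hδsum]
    rw [hKsum, ← Finset.sum_add_distrib]
    refine Finset.sum_le_sum fun e' he' => ?_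
    obtain ⟨hne, hinc⟩ := Finset.mem_erase.1 he'
    rw [add_comm]
    rcases hδD e' hne with h | h
    · exact ih e' w (G.mem_incident.1 hinc) (zbar e') (δ e') (B - |r e|) (hδ0 e' hne) h
        (hB' e' hne)
    · simp [h]

/-- The excess on `e` is undone on both sides, with opposite orientations `s` and `-s`. Counting `e`
only once leaves a saving per unit of at least `2 (2n + 2) - (2n + 2) - s * r e`, and `|r e| ≤ n +
1`. -/
theorem belief_lt {G : FlowNetwork V E} {c x : E → ℝ} (hx : G.IsFlow x)
    (hc : ∀ e, c e ∈ Icc (0 : ℝ) 1) {π : V → ℝ} {r : E → ℝ} (hπ : G.IsPotential c x π r)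
    (hπn : ∀ v, π v ∈ Icc (-(Fintype.card V : ℝ)) 0) (init : BPInit) {t : ℕ}
    (hB : ∀ s : ℝ, s = 1 ∨ s = -1 → ∀ w a, G.IsWalk s x t w a → NonBacktracking t a →
      2 * (Fintype.card V : ℝ) + 2 ≤ ∑ l ∈ Finset.range t, |r (a l)|)
    (e : E) {z : ℝ} (hz : z ≠ x e) : G.belief c init t e (x e) < G.belief c init t e z := by
  obtain ⟨p, hp⟩ : ∃ p : ℝ, G.message c init t e (G.src e) (x e) = p :=
    ⟨_, (EReal.coe_toReal (G.message_flow_lt_top hx init t e _).ne (ne_of_gt (lt_of_lt_of_le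
      (EReal.bot_lt_coe 0) (G.message_nonneg hc init t _ _ _)))).symm⟩
  obtain ⟨q, hq⟩ : ∃ q : ℝ, G.message c init t e (G.tgt e) (x e) = q :=
    ⟨_, (EReal.coe_toReal (G.message_flow_lt_top hx init t e _).ne (ne_of_gt (lt_of_lt_of_le
      (EReal.bot_lt_coe 0) (G.message_nonneg hc init t _ _ _)))).symm⟩
  have hbx : G.belief c init t e (x e) = ((p + q - c e * x e : ℝ) : EReal) := by
    rw [belief, if_pos (hx.1 e), hp, hq, edgeFactor, if_pos (hx.1 e)]
    push_cast; rfl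
  rw [hbx]
  by_cases hzc : 0 ≤ z ∧ z ≤ G.cap e
  swap
  · rw [belief, if_neg hzc]
    exact EReal.coe_lt_top _
  obtain ⟨s, hs, hsd⟩ : ∃ s : ℝ, (s = 1 ∨ s = -1) ∧ 0 < s * (z - x e) := by
    rcases lt_or_gt_of_ne hz with h | h
    · exact ⟨-1, Or.inr rfl, by linarith⟩
    · exact ⟨1, Or.inl rfl, by linarith⟩
  have hss : s * s = 1 := by rcases hs with rfl | rfl <;> norm_num
  set d := s * (z - x e) with hd
  have h1 := message_descent hx hc hπ hπn hs init t e (G.src e) (Or.inl rfl) z d _ hsd.le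
    (by simp [hd]) fun w a hw ha _ _ => hB s hs w a hw ha
  have hs' : -s = 1 ∨ -s = -1 := by rcases hs with rfl | rfl <;> simp
  have h2 := message_descent hx hc hπ hπn hs' init t e (G.tgt e) (Or.inr rfl) z d _ hsd.le
    (by simp [hd]) fun w a hw ha _ _ => hB (-s) hs' w a hw ha
  have e1 : z - s * G.sign (G.src e) e * d = x e := by
    rw [hd, sign_src]; linear_combination (x e - z) * hss
  have e2 : z - -s * G.sign (G.tgt e) e * d = x e := by
    rw [hd, sign_tgt]; linear_combination (x e - z) * hss
  rw [e1, hp, ← EReal.coe_add] at h1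
  rw [e2, hq, ← EReal.coe_add] at h2
  rw [belief, if_pos hzc, edgeFactor, if_pos hzc]
  refine lt_of_lt_of_le ?_ (EReal.sub_le_sub (add_le_add h1 h2) le_rfl)
  rw [← EReal.coe_add, ← EReal.coe_sub, EReal.coe_lt_coe_iff]
  have hzd : z = x e + s * d := by rw [hd]; linear_combination (x e - z) * hss
  obtain ⟨c1, c2⟩ := hc e
  obtain ⟨a1, a2⟩ := hπn (G.src e)
  obtain ⟨b1, b2⟩ := hπn (G.tgt e)
  have hsr : s * (c e + π (G.src e) - π (G.tgt e)) < 2 * (Fintype.card V : ℝ) + 2 := by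
    have : (0 : ℝ) ≤ Fintype.card V := Nat.cast_nonneg _
    rcases hs with rfl | rfl <;> linarith
  have := mul_lt_mul_of_pos_left hsr hsd
  rw [hzd]
  linarith

/-- Belief propagation is correct after `O(n² / ε)` iterations if the gap is at least `ε`. -/
theorem HasGap.convergedAt {G : FlowNetwork V E} {c x : E → ℝ} {ε : ℝ} (hG : G.HasGap c ε)
    (hε : 0 < ε) (hx : G.IsMinCostFlow c x) (hc : ∀ e, c e ∈ Icc (0 : ℝ) 1) (init : BPInit)
    {N k : ℕ} (hk : 2 * (Fintype.card V : ℝ) + 2 ≤ k * ε) (hN : k * Fintype.card V ≤ N) :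
    G.ConvergedAt c init N := by
  obtain ⟨π, r, hπ, hπn⟩ := hx.exists_potential hc
  refine ⟨x, hx, fun t ht e z => ⟨fun h => ?_, ?_⟩⟩
  · by_contra hz
    exact absurd (h (x e)) (not_le.2 (belief_lt hx.1 hc hπ hπn init
      (fun s hs w a hw ha => hk.trans (hw.mul_gap_le hG hε hx hπ hs ha (hN.trans ht))) e hz))
  · rintro rfl z'
    by_cases hz : z' = x e
    · rw [hz]
    · exact (belief_lt hx.1 hc hπ hπn init
        (fun s hs w a hw ha => hk.trans (hw.mul_gap_le hG hε hx hπ hs ha (hN.trans ht))) e hz).le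

end Messages

end FlowNetwork

/-! ### Probability estimates for smoothed costs -/

/-- Tonelli: integrate coordinate `i` first; the remaining measures are probability measures. -/
theorem pi_measure_le_of_slice_le {ι : Type*} [Fintype ι] [DecidableEq ι] (μ : ι → Measure ℝ)
    [∀ i, IsProbabilityMeasure (μ i)] {B : Set (ι → ℝ)} (hB : MeasurableSet B) (i : ι)
    {κ : ENNReal} (h : ∀ c : ι → ℝ, μ i {y | Function.update c i y ∈ B} ≤ κ) :
    Measure.pi μ B ≤ κ := by
  rw [← lintegral_indicator_one hB, lintegral_eq_lmarginal_univ 0,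
    lmarginal_erase' _ (measurable_one.indicator hB) (Finset.mem_univ i)]
  refine (lmarginal_mono (g := fun _ => κ) (fun c => ?_) 0).trans ?_
  · have hm : MeasurableSet {y | Function.update c i y ∈ B} := measurable_update c hB
    refine le_trans (le_of_eq ?_) (h c)
    rw [← lintegral_indicator_one hm]
    rfl
  · simp [lmarginal]

theorem IsSmoothedCost.law_le {Ω E : Type*} [MeasurableSpace Ω] {P : Measure Ω} {φ : ℝ}
    {f : E → ℝ → ℝ} {c : E → Ω → ℝ} (h : IsSmoothedCost P φ f c) (e : E) :
    P.map (c e) ≤ ENNReal.ofReal φ • volume.restrict (Icc (0 : ℝ) 1) := by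
  rw [h.law e, ← withDensity_const]
  refine withDensity_mono ?_
  filter_upwards [ae_restrict_mem measurableSet_Icc] with x hx
  exact ENNReal.ofReal_le_ofReal (h.density_mem e x hx).2

theorem IsSmoothedCost.one_le {Ω E : Type*} [MeasurableSpace Ω] {P : Measure Ω}
    [IsProbabilityMeasure P] {φ : ℝ} {f : E → ℝ → ℝ} {c : E → Ω → ℝ}
    (h : IsSmoothedCost P φ f c) (e : E) : 1 ≤ φ := by
  have := Measure.isProbabilityMeasure_map (μ := P) (h.cost_measurable e).aemeasurable
  have h1 := h.law_le e univ
  simpa using h1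

theorem IsSmoothedCost.ae_mem {Ω E : Type*} [Finite E] [MeasurableSpace Ω] {P : Measure Ω}
    {φ : ℝ} {f : E → ℝ → ℝ} {c : E → Ω → ℝ} (h : IsSmoothedCost P φ f c) :
    ∀ᵐ ω ∂P, ∀ e, c e ω ∈ Icc (0 : ℝ) 1 := by
  rw [ae_all_iff]
  intro e
  refine ae_of_ae_map (h.cost_measurable e).aemeasurable ?_
  rw [h.law e]
  exact (withDensity_absolutelyContinuous _ _).ae_le (ae_restrict_mem measurableSet_Icc)

/-- By independence the joint law is a product, and each slice in direction `e` has diameter at most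
`ε`, hence Lebesgue measure at most `ε`. -/
theorem IsSmoothedCost.measure_preimage_le {Ω E : Type*} [Fintype E] [DecidableEq E]
    [MeasurableSpace Ω] {P : Measure Ω} [IsProbabilityMeasure P] {φ : ℝ} {f : E → ℝ → ℝ}
    {c : E → Ω → ℝ} (h : IsSmoothedCost P φ f c) {B : Set (E → ℝ)} (hB : MeasurableSet B) (e : E)
    {ε : ℝ} (hBε : ∀ (b : E → ℝ) (y y' : ℝ), Function.update b e y ∈ B →
      Function.update b e y' ∈ B → |y - y'| ≤ ε) :
    P {ω | (fun e => c e ω) ∈ B} ≤ ENNReal.ofReal φ * ENNReal.ofReal ε := by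
  have hprob : ∀ e, IsProbabilityMeasure (P.map (c e)) := fun e =>
    Measure.isProbabilityMeasure_map (h.cost_measurable e).aemeasurable
  have hmeas : Measurable fun ω e => c e ω := measurable_pi_lambda _ h.cost_measurable
  have hmap := (iIndepFun_iff_map_fun_eq_pi_map
    fun e => (h.cost_measurable e).aemeasurable).1 h.indep
  change P ((fun ω e => c e ω) ⁻¹' B) ≤ _
  rw [← Measure.map_apply hmeas hB, hmap]
  refine pi_measure_le_of_slice_le _ hB e fun b => ?_
  refine (h.law_le e _).trans ?_
  rw [Measure.smul_apply, smul_eq_mul]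
  gcongr
  refine (Measure.restrict_apply_le _ _).trans ((Real.volume_le_diam _).trans ?_)
  refine Metric.ediam_le fun y hy y' hy' => ?_
  rw [edist_dist, Real.dist_eq]
  exact ENNReal.ofReal_le_ofReal (hBε b y y' hy hy')

/-! ### The isolation lemma -/

namespace FlowNetwork

variable {V E : Type*} [Fintype E] [DecidableEq V]

theorem isCompact_setOf_isFlow (G : FlowNetwork V E) : IsCompact {g | G.IsFlow g} := by
  have h1 : IsCompact (Set.univ.pi fun e => Icc (0 : ℝ) (G.cap e)) :=
    isCompact_univ_pi fun e => isCompact_Icc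
  have h2 : IsClosed {g : E → ℝ | ∀ v, G.BudgetAt v g} := by
    rw [Set.ofPred_forall]
    refine isClosed_iInter fun v => ?_
    unfold BudgetAt
    exact isClosed_eq (by fun_prop) continuous_const
  convert h1.inter_right h2 using 1
  ext g
  simp only [IsFlow, Set.mem_ofPred_eq, Set.mem_inter_iff, Set.mem_univ_pi, Set.mem_Icc]

theorem exists_isMinCostFlow {G : FlowNetwork V E} (hG : ∃ g, G.IsFlow g) (c : E → ℝ) :
    ∃ x, G.IsMinCostFlow c x := by
  obtain ⟨x, hx, hmin⟩ := G.isCompact_setOf_isFlow.exists_isMinOn hG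
    (f := fun x => ∑ e, c e * x e) (by fun_prop)
  exact ⟨x, hx, fun g hg => hmin hg⟩

/-- The minimum cost of a flow that has the value `a` on the edge `e`. -/
noncomputable def minCostAt (G : FlowNetwork V E) (e : E) (a : ℝ) (c : E → ℝ) : ℝ :=
  sInf ((fun x => ∑ i, c i * x i) '' {x | G.IsFlow x ∧ x e = a})

theorem isCompact_flowsAt (G : FlowNetwork V E) (e : E) (a : ℝ) :
    IsCompact {x | G.IsFlow x ∧ x e = a} :=
  G.isCompact_setOf_isFlow.inter_right (isClosed_eq (continuous_apply e) continuous_const)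

theorem continuous_minCostAt (G : FlowNetwork V E) (e : E) (a : ℝ) :
    Continuous (G.minCostAt e a) :=
  (G.isCompact_flowsAt e a).continuous_sInf
    (f := fun (c x : E → ℝ) => ∑ i, c i * x i) (by unfold Function.HasUncurry.uncurry; fun_prop)

theorem minCostAt_eq {G : FlowNetwork V E} {e : E} {a : ℝ} {c x : E → ℝ} (hx : G.IsFlow x)
    (hxa : x e = a) (hmin : ∀ y, G.IsFlow y → y e = a → ∑ i, c i * x i ≤ ∑ i, c i * y i) :
    G.minCostAt e a c = ∑ i, c i * x i := by
  refine IsLeast.csInf_eq ⟨⟨x, ⟨hx, hxa⟩, rfl⟩, ?_⟩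
  rintro _ ⟨y, hy, rfl⟩
  exact hmin y hy.1 hy.2

/-- The costs for which a flow with value `a` on the edge `e` is optimal, but changing the flow
on `e` is possible at a cost of less than `ε` per unit. -/
def cheapChange (G : FlowNetwork V E) (e : E) (a ε : ℝ) : Set (E → ℝ) :=
  {c | {x | G.IsFlow x ∧ x e = a}.Nonempty ∧ (∀ g, G.IsFlow g → G.minCostAt e a c ≤ ∑ i, c i * g i) ∧
    ∃ g, G.IsFlow g ∧ ∑ i, c i * g i - ε * |g e - a| < G.minCostAt e a c}

/-- Nonemptiness does not depend on the costs. By continuity of `minCostAt`, the uncountable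
quantifiers over `g` give an intersection of closed sets and a union of open sets. -/
theorem measurableSet_cheapChange (G : FlowNetwork V E) (e : E) (a ε : ℝ) :
    MeasurableSet (G.cheapChange e a ε) := by
  have hV := G.continuous_minCostAt e a
  refine (MeasurableSet.const _).inter (MeasurableSet.inter (s₁ := {c | ∀ g, G.IsFlow g → G.minCostAt e a c ≤ ∑ i, c i * g i})
    (s₂ := {c | ∃ g, G.IsFlow g ∧ ∑ i, c i * g i - ε * |g e - a| < G.minCostAt e a c})
    (IsClosed.measurableSet ?_) (IsOpen.measurableSet ?_))
  · simp only [Set.ofPred_forall]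
    exact isClosed_iInter fun g => isClosed_iInter fun _ => isClosed_le hV (by fun_prop)
  · simp only [Set.ofPred_exists, Set.ofPred_and]
    refine isOpen_iUnion fun g => ?_
    by_cases hg : G.IsFlow g
    · simpa [hg] using isOpen_lt (by fun_prop) hV
    · simp [hg]

theorem hasGap_of_notMem_cheapChange {G : FlowNetwork V E} {c : E → ℝ} {ε : ℝ}
    (h0 : ∀ e, c ∉ G.cheapChange e 0 ε) (h1 : ∀ e, c ∉ G.cheapChange e (G.cap e) ε) :
    G.HasGap c ε := by
  intro x hx e he g hg
  by_contra! hlt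
  have key : c ∈ G.cheapChange e (x e) ε := by
    have hV : G.minCostAt e (x e) c = ∑ i, c i * x i :=
      minCostAt_eq hx.1 rfl fun y hy _ => hx.2 y hy
    exact ⟨⟨x, hx.1, rfl⟩, fun g hg => hV ▸ hx.2 g hg, g, hg, by rw [hV]; linarith⟩
  rcases he with he | he <;> rw [he] at key
  exacts [h0 e key, h1 e key]

variable [DecidableEq E]

theorem sum_update_mul (c x : E → ℝ) (e : E) (y : ℝ) :
    ∑ i, Function.update c e y i * x i = ∑ i, c i * x i + (y - c e) * x e := by
  rw [← Finset.add_sum_erase _ _ (Finset.mem_univ e),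
    ← Finset.add_sum_erase _ (fun i => c i * x i) (Finset.mem_univ e)]
  have : ∑ i ∈ Finset.univ.erase e, Function.update c e y i * x i =
      ∑ i ∈ Finset.univ.erase e, c i * x i :=
    Finset.sum_congr rfl fun i hi => by
      rw [Function.update_of_ne (Finset.ne_of_mem_erase hi)]
  rw [this, Function.update_self]
  ring

/-- As `a` is a bound of the capacity interval, `g e - a` has a fixed sign `σ`. A flow that is a
cheap change at cost `y` would beat the optimum at `y'` if `σ * (y - y') ≥ ε`; exchanging `y` and
`y'` bounds the distance. -/
theorem abs_sub_le_of_mem_cheapChange (G : FlowNetwork V E) {e : E} {a ε : ℝ}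
    (ha : a = 0 ∨ a = G.cap e) (b : E → ℝ) (y y' : ℝ)
    (hy : Function.update b e y ∈ G.cheapChange e a ε)
    (hy' : Function.update b e y' ∈ G.cheapChange e a ε) : |y - y'| ≤ ε := by
  obtain ⟨σ, hσ, hside⟩ : ∃ σ : ℝ, (σ = 1 ∨ σ = -1) ∧
      ∀ g, G.IsFlow g → |g e - a| = σ * (g e - a) := by
    rcases ha with rfl | rfl
    · exact ⟨1, Or.inl rfl, fun g hg => by rw [abs_of_nonneg (by linarith [(hg.1 e).1]), one_mul]⟩
    · exact ⟨-1, Or.inr rfl, fun g hg => by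
        rw [abs_of_nonpos (by linarith [(hg.1 e).2]), neg_one_mul]⟩
  obtain ⟨x, ⟨hx, hxa⟩, hmin⟩ := (G.isCompact_flowsAt e a).exists_isMinOn hy.1
    (f := fun x => ∑ i, b i * x i) (by fun_prop)
  -- All flows with value `a` on `e` pay the same for `e`, so one minimizer `x` serves every `y`,
  -- and the minimum is affine in `y` with slope `a`.
  have hV : ∀ y, G.minCostAt e a (Function.update b e y) =
      ∑ i, b i * x i + (y - b e) * a := by
    intro y
    rw [minCostAt_eq hx hxa, sum_update_mul, hxa]
    intro z hz hza
    rw [sum_update_mul, sum_update_mul, hxa, hza]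
    exact add_le_add (hmin ⟨hz, hza⟩) le_rfl
  have key : ∀ y y', Function.update b e y ∈ G.cheapChange e a ε →
      Function.update b e y' ∈ G.cheapChange e a ε → σ * (y - y') < ε := by
    rintro y y' ⟨-, -, g, hg, hlt⟩ ⟨-, hle, -⟩
    have h1 := hle g hg
    rw [hV, sum_update_mul] at hlt h1
    have h2 := hside g hg
    have h3 : 0 < |g e - a| * (ε - σ * (y - y')) := by
      have hσσ : σ * σ = 1 := by rcases hσ with rfl | rfl <;> norm_num
      have h4 : g e - a = σ * |g e - a| := by rw [h2]; linear_combination -(g e - a) * hσσ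
      have h5 : (y - y') * (g e - a) = |g e - a| * (σ * (y - y')) := by
        linear_combination (y - y') * h4
      linarith
    by_contra! hcon
    linarith [mul_nonneg (abs_nonneg (g e - a)) (sub_nonneg.2 hcon)]
  have k1 := key y y' hy hy'
  have k2 := key y' y hy' hy
  rw [abs_le]
  rcases hσ with rfl | rfl <;> constructor <;> linarith

variable {Ω : Type*} [MeasurableSpace Ω]

/-- The isolation lemma: with high probability, there is a gap. -/
theorem measure_not_hasGap_le (G : FlowNetwork V E) {P : Measure Ω} [IsProbabilityMeasure P]
    {φ : ℝ} {f : E → ℝ → ℝ} {c : E → Ω → ℝ} (h : IsSmoothedCost P φ f c) (ε : ℝ) :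
    P {ω | ¬ G.HasGap (fun e => c e ω) ε} ≤
      Fintype.card E * (2 * (ENNReal.ofReal φ * ENNReal.ofReal ε)) := by
  have hsub : {ω | ¬ G.HasGap (fun e => c e ω) ε} ⊆
      ⋃ e, ({ω | (fun e => c e ω) ∈ G.cheapChange e 0 ε} ∪
        {ω | (fun e => c e ω) ∈ G.cheapChange e (G.cap e) ε}) := by
    intro ω hω
    by_contra hcon
    simp only [Set.mem_iUnion, not_exists, Set.mem_union, not_or] at hcon
    exact hω (hasGap_of_notMem_cheapChange (fun e => (hcon e).1) fun e => (hcon e).2)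
  refine (measure_mono hsub).trans ((measure_iUnion_fintype_le _ _).trans ?_)
  have hle : ∀ e ∈ Finset.univ, P ({ω | (fun e => c e ω) ∈ G.cheapChange e 0 ε} ∪
      {ω | (fun e => c e ω) ∈ G.cheapChange e (G.cap e) ε}) ≤
        2 * (ENNReal.ofReal φ * ENNReal.ofReal ε) := by
    intro e _
    refine (measure_union_le _ _).trans ?_
    rw [two_mul]
    exact add_le_add
      (h.measure_preimage_le (G.measurableSet_cheapChange e _ ε) e
        (G.abs_sub_le_of_mem_cheapChange (Or.inl rfl)))
      (h.measure_preimage_le (G.measurableSet_cheapChange e _ ε) e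
        (G.abs_sub_le_of_mem_cheapChange (Or.inr rfl)))
  refine (Finset.sum_le_sum hle).trans ?_
  simp

/-! ### From the gap to the tail bound -/

theorem ConvergedAt.iterations_le {G : FlowNetwork V E} {c : E → ℝ} {init : BPInit} {N : ℕ}
    (h : G.ConvergedAt c init N) (hN : 1 ≤ N) : G.iterations c init ≤ N :=
  iInf₂_le N ⟨hN, h⟩

/-- A gap of `8 n² / t` makes belief propagation converge in less than `t` iterations. -/
theorem HasGap.iterations_lt [Fintype V] [Nonempty V] {G : FlowNetwork V E}
    (hflow : ∃ g, G.IsFlow g) {c : E → ℝ} (hc : ∀ e, c e ∈ Icc (0 : ℝ) 1) (init : BPInit) {t : ℝ}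
    (ht : 16 * (Fintype.card V : ℝ) ^ 2 ≤ t)
    (hG : G.HasGap c (8 * (Fintype.card V : ℝ) ^ 2 / t)) :
    ((G.iterations c init : ℕ∞) : ENNReal) < ENNReal.ofReal t := by
  obtain ⟨x, hx⟩ := exists_isMinCostFlow hflow c
  have hn0 : 0 < Fintype.card V := Fintype.card_pos
  have hn : (1 : ℝ) ≤ Fintype.card V := by exact_mod_cast hn0
  set n : ℝ := (Fintype.card V : ℝ) with hn_def
  have ht0 : 0 < t := by nlinarith
  set ε := 8 * n ^ 2 / t with hε
  have hε0 : 0 < ε := by positivity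
  set k := ⌈(2 * n + 2) / ε⌉₊ with hk
  have hk1 : 2 * n + 2 ≤ k * ε := by
    rw [← div_le_iff₀ hε0]
    exact Nat.le_ceil _
  have hk2 : (k : ℝ) < (2 * n + 2) / ε + 1 := Nat.ceil_lt_add_one (by positivity)
  have hk0 : 0 < k := Nat.ceil_pos.2 (by positivity)
  have hconv := hG.convergedAt hε0 hx hc init (N := k * Fintype.card V) hk1 le_rfl
  have hle := hconv.iterations_le (Nat.mul_pos hk0 hn0)
  have hlt : ((k * Fintype.card V : ℕ) : ℝ) < t := by
    push_cast
    rw [← hn_def]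
    -- Rounding up to `k` adds at most `n` more iterations, and `n ≤ t / 16` since `16 n² ≤ t`.
    have h1 : (2 * n + 2) / ε * n ≤ t / 2 := by
      have : (2 * n + 2) / ε * n = t / 2 * ((n + 1) / (2 * n)) := by
        rw [hε]; field_simp; ring
      rw [this]
      refine mul_le_of_le_one_right (by positivity) ?_
      rw [div_le_one (by positivity)]
      linarith
    nlinarith
  calc ((G.iterations c init : ℕ∞) : ENNReal) ≤ (((k * Fintype.card V : ℕ) : ℕ∞) : ENNReal) :=
        ENat.toENNReal_le.2 hle
    _ = ENNReal.ofReal ((k * Fintype.card V : ℕ) : ℝ) := by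
        rw [ENNReal.ofReal_natCast, ENat.toENNReal_coe]
    _ < ENNReal.ofReal t := (ENNReal.ofReal_lt_ofReal_iff ht0).2 hlt

end FlowNetwork

theorem mainTheorem1 :
    ∃ C : ℝ, 0 < C ∧
      ∀ (V E Ω : Type*) [Fintype V] [Fintype E] [DecidableEq V] [DecidableEq E] [Nonempty E]
        [MeasurableSpace Ω] (P : Measure Ω) [IsProbabilityMeasure P]
        (G : FlowNetwork V E) (init : BPInit) (φ : ℝ) (f : E → ℝ → ℝ) (c : E → Ω → ℝ),
        (∃ g, G.IsFlow g) → IsSmoothedCost P φ f c →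
        ∀ t : ℝ, 0 < t →
          P {ω | ENNReal.ofReal t ≤ ((G.iterations (fun e => c e ω) init : ℕ∞) : ENNReal)} ≤
            ENNReal.ofReal
              (C * (Fintype.card V : ℝ) ^ 2 * (Fintype.card E : ℝ) * φ / t) := by
  refine ⟨16, by norm_num, ?_⟩
  intro V E Ω _ _ _ _ hE _ P _ G init φ f c hflow hsc t ht
  have : Nonempty V := ⟨G.src hE.some⟩
  have hφ : 1 ≤ φ := hsc.one_le hE.some
  have hm : (1 : ℝ) ≤ Fintype.card E := by exact_mod_cast Fintype.card_pos (α := E)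
  -- For `t < 16 n²` the claimed bound exceeds `1`, because `m * φ ≥ 1`. For larger `t`, the
  -- isolation lemma with `ε = 8 n² / t` gives `2 m φ ε = 16 n² m φ / t`.
  rcases lt_or_ge t (16 * (Fintype.card V : ℝ) ^ 2) with hlt | hge
  · refine prob_le_one.trans ?_
    rw [ENNReal.one_le_ofReal, one_le_div ht]
    have h1 : 1 ≤ (Fintype.card E : ℝ) * φ := one_le_mul_of_one_le_of_one_le hm hφ
    have h2 : (0 : ℝ) ≤ 16 * (Fintype.card V : ℝ) ^ 2 := by positivity
    rw [mul_assoc]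
    exact hlt.le.trans (le_mul_of_one_le_right h2 h1)
  · refine le_trans (measure_mono_ae ?_)
      ((G.measure_not_hasGap_le hsc (8 * (Fintype.card V : ℝ) ^ 2 / t)).trans (le_of_eq ?_))
    · filter_upwards [hsc.ae_mem] with ω hω hle hgap
      exact absurd hle (not_le.2 (hgap.iterations_lt hflow hω init hge))
    · rw [← ENNReal.ofReal_mul (by linarith), ← ENNReal.ofReal_ofNat 2,
        ← ENNReal.ofReal_mul (by norm_num), ← ENNReal.ofReal_natCast,
        ← ENNReal.ofReal_mul (by positivity)]
      congr 1
      ring
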